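/- Let $E=(E^0,E^1,r,s)$ be an arbitrary directed graph and let $R$ be a commutative ring with unit. A vertex $v$ is regular if $s^{-1}(v)$ is finite and non-empty. The Leavitt path algebra $L_R(E)$ is the universal (associative, not necessarily unital) $R$-algebra generated by pairwise orthogonal idempotents $v$ ($v\in E^0$) and elements $e,e^*$ ($e\in E^1$) subject to (1) $s(e)e=e=e\,r(e)$ and (2) $r(e)e^*=e^*=e^*s(e)$ for all $e\in E^1$; (3) $e^*e=r(e)$ for all $e \in E^1$, and $e^*f=0$ for all $e\ne f$ in $E^1$; (4) $v=\sum_{s(e)=v}ee^*$ for every regular vertex $v$. It carries the $R$-linear involution $x\mapsto x^*$ (reversing products) that fixes every vertex and exchanges $e$ and $e^*$. Finite paths $\alpha=e_1\cdots e_n$ (with $r(e_i)=s(e_{i+1})$; vertices are the paths of length $0$) are regarded as elements of $L_R(E)$, and $\alpha^*=e_n^*\cdots e_1^*$. Let $G_E^M$ be the set of all elements $x=\alpha\beta^*$, where $\alpha,\beta$ are finite paths with $r(\alpha)=r(\beta)$, that are normal, i.e. $xx^*=x^*x$. The commutative core $M_R(E)$ is the $R$-subalgebra (not required to contain a unit)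 of $L_R(E)$ generated by $G_E^M$. Then the center $$Z(L_R(E))=\{x\in L_R(E): xy=yx\text{ for every }y\in L_R(E)\}$$ satisfies $Z(L_R(E))\subseteq M_R(E)$. -/

import Mathlib

/-- A directed graph with vertex set `V`, edge set `E`, source map `s` and range map `r`;
both sets are arbitrary, and loops and multiple edges are allowed. -/
structure DirectedGraph (V : Type*) (E : Type*) where
  s : E → V
  r : E → V

namespace DirectedGraph

variable {V : Type*} {E : Type*}

/-- A regular vertex emits at least one and only finitely many edges. -/
def IsRegular (G : DirectedGraph V E) (v : V) : Prop :=
  {e : E | G.s e = v}.Finite ∧ {e : E | G.s e = v}.Nonempty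

/-- `G.IsPathFrom v l`: the list of edges `l = [e₁, …, eₙ]` satisfies `s(e₁) = v` and
`r(eᵢ) = s(eᵢ₊₁)`; the empty list is a path of length `0` from every vertex. -/
def IsPathFrom (G : DirectedGraph V E) : V → List E → Prop
  | _, [] => True
  | v, e :: l => G.s e = v ∧ G.IsPathFrom (G.r e) l

/-- The last vertex reached from `v` along a list of edges. -/
def endpoint (G : DirectedGraph V E) : V → List E → V
  | v, [] => v
  | _, e :: l => G.endpoint (G.r e) l

/-- A finite path. Vertices are the paths with an empty list of edges. -/
structure Path (G : DirectedGraph V E) where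
  source : V
  edges : List E
  isPathFrom : G.IsPathFrom source edges

/-- The range `r(α)` of a path. -/
def Path.range {G : DirectedGraph V E} (α : G.Path) : V := G.endpoint α.source α.edges

/-- The generators of the Leavitt path algebra: vertices, edges and ghost edges. -/
inductive Gen (V : Type*) (E : Type*)
  | vertex (v : V) : Gen V E
  | edge (e : E) : Gen V E
  | ghost (e : E) : Gen V E

/-- The free associative, non-unital `R`-algebra on the vertices, edges and ghost edges. -/
abbrev FreeAlg (R : Type*) [CommRing R] (V : Type*) (E : Type*) :=
  MonoidAlgebra R (FreeSemigroup (Gen V E))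

/-- A generator, as an element of the free algebra. -/
noncomputable def FreeAlg.of (R : Type*) [CommRing R] {V : Type*} {E : Type*} (g : Gen V E) :
    FreeAlg R V E :=
  MonoidAlgebra.single (FreeSemigroup.of g) 1

/-- The relations satisfied by the generators `p v` (vertices), `x e` (edges) and `y e` (ghost
edges) of a Leavitt path algebra, in an arbitrary non-unital ring. -/
structure IsLeavittFamily (G : DirectedGraph V E) {A : Type*} [NonUnitalRing A]
    (p : V → A) (x y : E → A) : Prop where
  vertex_idem : ∀ v, p v * p v = p v
  vertex_orth : ∀ v w, v ≠ w → p v * p w = 0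
  source_edge : ∀ e, p (G.s e) * x e = x e
  edge_range : ∀ e, x e * p (G.r e) = x e
  range_ghost : ∀ e, p (G.r e) * y e = y e
  ghost_source : ∀ e, y e * p (G.s e) = y e
  ghost_edge_self : ∀ e, y e * x e = p (G.r e)
  ghost_edge : ∀ e f, e ≠ f → y e * x f = 0
  vertex_eq_sum : ∀ v (h : G.IsRegular v), p v = ∑ e ∈ h.1.toFinset, x e * y e

open FreeAlg in
/-- The same relations, as pairs of elements of the free algebra. -/
inductive LeavittRel (G : DirectedGraph V E) (R : Type*) [CommRing R] :
    FreeAlg R V E → FreeAlg R V E → Prop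
  | vertex_idem (v : V) :
      LeavittRel G R (of R (.vertex v) * of R (.vertex v)) (of R (.vertex v))
  | vertex_orth (v w : V) (h : v ≠ w) :
      LeavittRel G R (of R (.vertex v) * of R (.vertex w)) 0
  | source_edge (e : E) :
      LeavittRel G R (of R (.vertex (G.s e)) * of R (.edge e)) (of R (.edge e))
  | edge_range (e : E) :
      LeavittRel G R (of R (.edge e) * of R (.vertex (G.r e))) (of R (.edge e))
  | range_ghost (e : E) :
      LeavittRel G R (of R (.vertex (G.r e)) * of R (.ghost e)) (of R (.ghost e))
  | ghost_source (e : E) :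
      LeavittRel G R (of R (.ghost e) * of R (.vertex (G.s e))) (of R (.ghost e))
  | ghost_edge_self (e : E) :
      LeavittRel G R (of R (.ghost e) * of R (.edge e)) (of R (.vertex (G.r e)))
  | ghost_edge (e f : E) (h : e ≠ f) :
      LeavittRel G R (of R (.ghost e) * of R (.edge f)) 0
  | vertex_eq_sum (v : V) (h : G.IsRegular v) :
      LeavittRel G R (of R (.vertex v))
        (∑ e ∈ h.1.toFinset, of R (.edge e) * of R (.ghost e))

/-- The smallest congruence of the free algebra, compatible with scalar multiplication, which
contains the Leavitt relations. -/
noncomputable def leavittCon (G : DirectedGraph V E) (R : Type*) [CommRing R] :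
    RingCon (FreeAlg R V E) :=
  ringConGen fun a b => ∃ (t : R) (a' b' : FreeAlg R V E),
    LeavittRel G R a' b' ∧ a = t • a' ∧ b = t • b'

theorem leavittCon_smul (G : DirectedGraph V E) {R : Type*} [CommRing R] (t : R)
    {a b : FreeAlg R V E} (h : G.leavittCon R a b) : G.leavittCon R (t • a) (t • b) := by
  change RingConGen.Rel _ _ _ at h
  induction h with
  | of a b h =>
    obtain ⟨u, a', b', h, rfl, rfl⟩ := h
    exact RingConGen.Rel.of _ _ ⟨t * u, a', b', h, by rw [mul_smul], by rw [mul_smul]⟩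
  | refl a => exact (G.leavittCon R).refl _
  | symm _ ih => exact (G.leavittCon R).symm ih
  | trans _ _ ih1 ih2 => exact (G.leavittCon R).trans ih1 ih2
  | add _ _ ih1 ih2 => simpa only [smul_add] using (G.leavittCon R).add ih1 ih2
  | mul _ h2 ih1 _ => simpa only [smul_mul_assoc] using (G.leavittCon R).mul ih1 h2

end DirectedGraph

/-- The Leavitt path algebra `L_R(E)`: the universal (associative, not necessarily unital)
`R`-algebra generated by vertices, edges and ghost edges subject to the Leavitt relations.
The universal property is `LeavittPathAlgebra.lift` together with
`LeavittPathAlgebra.hom_ext`. -/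
def LeavittPathAlgebra {V : Type*} {E : Type*} (R : Type*) [CommRing R]
    (G : DirectedGraph V E) :=
  (G.leavittCon R).Quotient

namespace LeavittPathAlgebra

open DirectedGraph

variable {V : Type*} {E : Type*} {R : Type*} [CommRing R] {G : DirectedGraph V E}

noncomputable instance : NonUnitalRing (LeavittPathAlgebra R G) :=
  inferInstanceAs (NonUnitalRing (G.leavittCon R).Quotient)

/-- The quotient map from the free algebra. -/
noncomputable def mk (a : FreeAlg R V E) : LeavittPathAlgebra R G :=
  (a : (G.leavittCon R).Quotient)

theorem mk_surjective : Function.Surjective (mk : FreeAlg R V E → LeavittPathAlgebra R G) :=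
  fun x => Quotient.inductionOn' x fun a => ⟨a, rfl⟩

theorem mk_add (a b : FreeAlg R V E) : (mk (a + b) : LeavittPathAlgebra R G) = mk a + mk b := rfl

theorem mk_mul (a b : FreeAlg R V E) : (mk (a * b) : LeavittPathAlgebra R G) = mk a * mk b := rfl

theorem mk_zero : (mk 0 : LeavittPathAlgebra R G) = 0 := rfl

theorem mk_eq {a b : FreeAlg R V E} :
    (mk a : LeavittPathAlgebra R G) = mk b ↔ G.leavittCon R a b :=
  (G.leavittCon R).eq

noncomputable instance : SMul R (LeavittPathAlgebra R G) where
  smul t := Quotient.map' (t • ·) fun _ _ h => G.leavittCon_smul t h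

theorem mk_smul (t : R) (a : FreeAlg R V E) :
    (mk (t • a) : LeavittPathAlgebra R G) = t • mk a := rfl

noncomputable instance : Module R (LeavittPathAlgebra R G) where
  one_smul x := by
    obtain ⟨a, rfl⟩ := mk_surjective x
    rw [← mk_smul, one_smul]
  mul_smul t u x := by
    obtain ⟨a, rfl⟩ := mk_surjective x
    rw [← mk_smul, ← mk_smul, ← mk_smul, mul_smul]
  smul_zero t := by rw [← mk_zero, ← mk_smul, smul_zero]
  smul_add t x y := by
    obtain ⟨a, rfl⟩ := mk_surjective x
    obtain ⟨b, rfl⟩ := mk_surjective y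
    rw [← mk_add, ← mk_smul, ← mk_smul, ← mk_smul, ← mk_add, smul_add]
  add_smul t u x := by
    obtain ⟨a, rfl⟩ := mk_surjective x
    rw [← mk_smul, ← mk_smul, ← mk_smul, ← mk_add, add_smul]
  zero_smul x := by
    obtain ⟨a, rfl⟩ := mk_surjective x
    rw [← mk_smul, zero_smul, mk_zero]

instance : IsScalarTower R (LeavittPathAlgebra R G) (LeavittPathAlgebra R G) where
  smul_assoc t x y := by
    obtain ⟨a, rfl⟩ := mk_surjective x
    obtain ⟨b, rfl⟩ := mk_surjective y
    change mk (t • a) * mk b = t • (mk (a * b))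
    rw [← mk_mul, ← mk_smul, smul_mul_assoc]

instance : SMulCommClass R (LeavittPathAlgebra R G) (LeavittPathAlgebra R G) where
  smul_comm t x y := by
    obtain ⟨a, rfl⟩ := mk_surjective x
    obtain ⟨b, rfl⟩ := mk_surjective y
    change t • (mk (a * b)) = mk a * mk (t • b)
    rw [← mk_mul, ← mk_smul, mul_smul_comm]

/-- The quotient map as a homomorphism of `R`-algebras. -/
noncomputable def mkHom (R : Type*) [CommRing R] (G : DirectedGraph V E) :
    FreeAlg R V E →ₙₐ[R] LeavittPathAlgebra R G where
  toFun := mk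
  map_smul' _ _ := rfl
  map_zero' := rfl
  map_add' _ _ := rfl
  map_mul' _ _ := rfl

/-- The vertex `v` as an element of the Leavitt path algebra. -/
noncomputable def vertex (R : Type*) [CommRing R] (G : DirectedGraph V E) (v : V) :
    LeavittPathAlgebra R G := mkHom R G (FreeAlg.of R (.vertex v))

/-- The edge `e` as an element of the Leavitt path algebra. -/
noncomputable def edge (R : Type*) [CommRing R] (G : DirectedGraph V E) (e : E) :
    LeavittPathAlgebra R G := mkHom R G (FreeAlg.of R (.edge e))

/-- The ghost edge `e*` as an element of the Leavitt path algebra. -/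
noncomputable def ghost (R : Type*) [CommRing R] (G : DirectedGraph V E) (e : E) :
    LeavittPathAlgebra R G := mkHom R G (FreeAlg.of R (.ghost e))

theorem mkHom_eq_of_rel {a b : FreeAlg R V E} (h : LeavittRel G R a b) :
    mkHom R G a = mkHom R G b :=
  mk_eq.2 (RingConGen.Rel.of _ _ ⟨1, a, b, h, (one_smul _ _).symm, (one_smul _ _).symm⟩)

/-- The generators of the Leavitt path algebra satisfy the Leavitt relations. -/
theorem isLeavittFamily (R : Type*) [CommRing R] (G : DirectedGraph V E) :
    IsLeavittFamily G (vertex R G) (edge R G) (ghost R G) where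
  vertex_idem v := by
    simpa only [vertex, edge, ghost, map_mul] using mkHom_eq_of_rel (LeavittRel.vertex_idem v)
  vertex_orth v w h := by
    simpa only [vertex, edge, ghost, map_mul, map_zero] using mkHom_eq_of_rel (LeavittRel.vertex_orth v w h)
  source_edge e := by
    simpa only [vertex, edge, ghost, map_mul] using mkHom_eq_of_rel (LeavittRel.source_edge e)
  edge_range e := by
    simpa only [vertex, edge, ghost, map_mul] using mkHom_eq_of_rel (LeavittRel.edge_range e)
  range_ghost e := by
    simpa only [vertex, edge, ghost, map_mul] using mkHom_eq_of_rel (LeavittRel.range_ghost e)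
  ghost_source e := by
    simpa only [vertex, edge, ghost, map_mul] using mkHom_eq_of_rel (LeavittRel.ghost_source e)
  ghost_edge_self e := by
    simpa only [vertex, edge, ghost, map_mul] using mkHom_eq_of_rel (LeavittRel.ghost_edge_self e)
  ghost_edge e f h := by
    simpa only [vertex, edge, ghost, map_mul, map_zero] using mkHom_eq_of_rel (LeavittRel.ghost_edge e f h)
  vertex_eq_sum v h := by
    simpa only [vertex, edge, ghost, map_mul, map_sum] using mkHom_eq_of_rel (LeavittRel.vertex_eq_sum v h)

section Universal

variable {A : Type*} [NonUnitalRing A] [Module R A]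

/-- Two homomorphisms out of the Leavitt path algebra which agree on vertices, edges and ghost
edges are equal. -/
theorem hom_ext [IsScalarTower R A A] [SMulCommClass R A A]
    {φ ψ : LeavittPathAlgebra R G →ₙₐ[R] A}
    (hv : ∀ v, φ (vertex R G v) = ψ (vertex R G v)) (he : ∀ e, φ (edge R G e) = ψ (edge R G e))
    (hg : ∀ e, φ (ghost R G e) = ψ (ghost R G e)) : φ = ψ := by
  have key : φ.comp (mkHom R G) = ψ.comp (mkHom R G) := by
    apply MonoidAlgebra.nonUnitalAlgHom_ext' R
    apply FreeSemigroup.hom_ext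
    funext g
    cases g with
    | vertex v => exact hv v
    | edge e => exact he e
    | ghost e => exact hg e
  ext x
  obtain ⟨a, rfl⟩ := mk_surjective x
  exact DFunLike.congr_fun key a

variable [IsScalarTower R A A] [SMulCommClass R A A]

/-- The homomorphism from the free algebra with prescribed values on the generators. -/
noncomputable def freeLift (R : Type*) [CommRing R] [Module R A] [IsScalarTower R A A]
    [SMulCommClass R A A] (p : V → A) (x y : E → A) : FreeAlg R V E →ₙₐ[R] A :=
  MonoidAlgebra.liftMagma R (FreeSemigroup.lift fun g : Gen V E =>
    match g with
    | .vertex v => p v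
    | .edge e => x e
    | .ghost e => y e)

theorem freeLift_vertex (p : V → A) (x y : E → A) (v : V) :
    freeLift R p x y (FreeAlg.of R (.vertex v)) = p v := by
  simp [freeLift, FreeAlg.of]

theorem freeLift_edge (p : V → A) (x y : E → A) (e : E) :
    freeLift R p x y (FreeAlg.of R (.edge e)) = x e := by
  simp [freeLift, FreeAlg.of]

theorem freeLift_ghost (p : V → A) (x y : E → A) (e : E) :
    freeLift R p x y (FreeAlg.of R (.ghost e)) = y e := by
  simp [freeLift, FreeAlg.of]

theorem freeLift_eq_of_rel {p : V → A} {x y : E → A} (H : IsLeavittFamily G p x y)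
    {a b : FreeAlg R V E} (h : LeavittRel G R a b) : freeLift R p x y a = freeLift R p x y b := by
  cases h with
  | vertex_idem v => simpa only [map_mul, freeLift_vertex] using H.vertex_idem v
  | vertex_orth v w h => simpa only [map_mul, map_zero, freeLift_vertex] using H.vertex_orth v w h
  | source_edge e => simpa only [map_mul, freeLift_vertex, freeLift_edge] using H.source_edge e
  | edge_range e => simpa only [map_mul, freeLift_vertex, freeLift_edge] using H.edge_range e
  | range_ghost e => simpa only [map_mul, freeLift_vertex, freeLift_ghost] using H.range_ghost e
  | ghost_source e => simpa only [map_mul, freeLift_vertex, freeLift_ghost] using H.ghost_source e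
  | ghost_edge_self e =>
    simpa only [map_mul, freeLift_vertex, freeLift_edge, freeLift_ghost] using H.ghost_edge_self e
  | ghost_edge e f h =>
    simpa only [map_mul, map_zero, freeLift_edge, freeLift_ghost] using H.ghost_edge e f h
  | vertex_eq_sum v h =>
    simpa only [map_mul, map_sum, freeLift_vertex, freeLift_edge, freeLift_ghost] using
      H.vertex_eq_sum v h

theorem freeLift_eq_of_con {p : V → A} {x y : E → A} (H : IsLeavittFamily G p x y)
    {a b : FreeAlg R V E} (h : G.leavittCon R a b) :
    freeLift R p x y a = freeLift R p x y b := by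
  change RingConGen.Rel _ _ _ at h
  induction h with
  | of a b h =>
    obtain ⟨u, a', b', h, rfl, rfl⟩ := h
    rw [map_smul, map_smul, freeLift_eq_of_rel H h]
  | refl a => rfl
  | symm _ ih => exact ih.symm
  | trans _ _ ih1 ih2 => exact ih1.trans ih2
  | add _ _ ih1 ih2 => rw [map_add, map_add, ih1, ih2]
  | mul _ _ ih1 ih2 => rw [map_mul, map_mul, ih1, ih2]

/-- Every family satisfying the Leavitt relations in an `R`-algebra `A` is the image of the
generators under a homomorphism from the Leavitt path algebra. -/
noncomputable def lift {p : V → A} {x y : E → A} (H : IsLeavittFamily G p x y) :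
    LeavittPathAlgebra R G →ₙₐ[R] A where
  toFun := Quotient.lift (freeLift R p x y) fun _ _ h => freeLift_eq_of_con H h
  map_smul' t x := by
    obtain ⟨a, rfl⟩ := mk_surjective x
    exact map_smul (freeLift R _ _ _) t a
  map_zero' := map_zero (freeLift R _ _ _)
  map_add' x y := by
    obtain ⟨a, rfl⟩ := mk_surjective x
    obtain ⟨b, rfl⟩ := mk_surjective y
    exact map_add (freeLift R _ _ _) a b
  map_mul' x y := by
    obtain ⟨a, rfl⟩ := mk_surjective x
    obtain ⟨b, rfl⟩ := mk_surjective y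
    exact map_mul (freeLift R _ _ _) a b

@[simp]
theorem lift_vertex {p : V → A} {x y : E → A} (H : IsLeavittFamily G p x y) (v : V) :
    lift (R := R) H (vertex R G v) = p v := freeLift_vertex p x y v

@[simp]
theorem lift_edge {p : V → A} {x y : E → A} (H : IsLeavittFamily G p x y) (e : E) :
    lift (R := R) H (edge R G e) = x e := freeLift_edge p x y e

@[simp]
theorem lift_ghost {p : V → A} {x y : E → A} (H : IsLeavittFamily G p x y) (e : E) :
    lift (R := R) H (ghost R G e) = y e := freeLift_ghost p x y e

end Universal

open MulOpposite in
/-- In the opposite algebra, vertices, ghost edges and edges form a Leavitt family. -/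
theorem isLeavittFamily_op (R : Type*) [CommRing R] (G : DirectedGraph V E) :
    IsLeavittFamily G (fun v => op (vertex R G v)) (fun e => op (ghost R G e))
      (fun e => op (edge R G e)) where
  vertex_idem v := by rw [← op_mul, (isLeavittFamily R G).vertex_idem]
  vertex_orth v w h := by rw [← op_mul, (isLeavittFamily R G).vertex_orth w v h.symm, op_zero]
  source_edge e := by rw [← op_mul, (isLeavittFamily R G).ghost_source]
  edge_range e := by rw [← op_mul, (isLeavittFamily R G).range_ghost]
  range_ghost e := by rw [← op_mul, (isLeavittFamily R G).edge_range]
  ghost_source e := by rw [← op_mul, (isLeavittFamily R G).source_edge]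
  ghost_edge_self e := by rw [← op_mul, (isLeavittFamily R G).ghost_edge_self]
  ghost_edge e f h := by rw [← op_mul, (isLeavittFamily R G).ghost_edge f e h.symm, op_zero]
  vertex_eq_sum v h := by
    simp only [← op_mul]
    rw [(isLeavittFamily R G).vertex_eq_sum v h, Finset.op_sum]

/-- The involution as a homomorphism to the opposite algebra. -/
noncomputable def starHom (R : Type*) [CommRing R] (G : DirectedGraph V E) :
    LeavittPathAlgebra R G →ₙₐ[R] (LeavittPathAlgebra R G)ᵐᵒᵖ :=
  lift (isLeavittFamily_op R G)

/-- The involution of the Leavitt path algebra: the `R`-linear anti-automorphism fixing the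
vertices and exchanging `e` and `e*`. -/
noncomputable instance : Star (LeavittPathAlgebra R G) where
  star x := (starHom R G x).unop

theorem star_def (x : LeavittPathAlgebra R G) : star x = (starHom R G x).unop := rfl

@[simp]
theorem star_vertex (v : V) : star (vertex R G v) = vertex R G v := by
  simp [star_def, starHom]

@[simp]
theorem star_edge (e : E) : star (edge R G e) = ghost R G e := by
  simp [star_def, starHom]

@[simp]
theorem star_ghost (e : E) : star (ghost R G e) = edge R G e := by
  simp [star_def, starHom]

/-- The involution is `R`-linear. -/
theorem star_smul_eq (t : R) (x : LeavittPathAlgebra R G) : star (t • x) = t • star x := by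
  simp [star_def]

noncomputable instance : StarRing (LeavittPathAlgebra R G) where
  star_mul x y := by simp [star_def]
  star_add x y := by simp [star_def]
  star_involutive x := by
    let ψ : LeavittPathAlgebra R G →ₙₐ[R] LeavittPathAlgebra R G :=
      { toFun := fun x => star (star x)
        map_smul' := fun t x => by simp [star_smul_eq]
        map_zero' := by simp [star_def]
        map_add' := fun x y => by simp [star_def]
        map_mul' := fun x y => by simp [star_def] }
    have h : ψ = NonUnitalAlgHom.id R (LeavittPathAlgebra R G) :=
      hom_ext (fun v => by simp [ψ]) (fun e => by simp [ψ]) (fun e => by simp [ψ])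
    exact DFunLike.congr_fun h x

/-- The product `e₁ ⋯ eₙ · w` of the edges of a list and its last vertex `w`, starting from the
vertex `v`. -/
noncomputable def monomial (R : Type*) [CommRing R] (G : DirectedGraph V E) :
    V → List E → LeavittPathAlgebra R G
  | v, [] => vertex R G v
  | _, e :: l => edge R G e * monomial R G (G.r e) l

/-- A path as an element of the Leavitt path algebra: a vertex `v` goes to `v`, and a path
`e₁ … eₙ` of positive length goes to the product `e₁ ⋯ eₙ = e₁ ⋯ eₙ · r(eₙ)`. Its ghost path
`eₙ* ⋯ e₁*` is `star (pathElem R α)`. -/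
noncomputable def pathElem (R : Type*) [CommRing R] {G : DirectedGraph V E} (α : G.Path) :
    LeavittPathAlgebra R G := monomial R G α.source α.edges

/-- The standard generators `α β*`, where `α` and `β` are paths with `r(α) = r(β)`. -/
def standardGenerators (R : Type*) [CommRing R] (G : DirectedGraph V E) :
    Set (LeavittPathAlgebra R G) :=
  {x | ∃ α β : G.Path, α.range = β.range ∧ x = pathElem R α * star (pathElem R β)}

/-- The standard generators `x` that are normal, i.e. `x x* = x* x`. -/
def normalGenerators (R : Type*) [CommRing R] (G : DirectedGraph V E) :
    Set (LeavittPathAlgebra R G) :=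
  {x | x ∈ standardGenerators R G ∧ x * star x = star x * x}

/-- The commutative core `M_R(E)`: the `R`-subalgebra of `L_R(E)` generated by the normal
standard generators. -/
noncomputable def commutativeCore (R : Type*) [CommRing R] (G : DirectedGraph V E) :
    NonUnitalSubalgebra R (LeavittPathAlgebra R G) :=
  NonUnitalAlgebra.adjoin R (normalGenerators R G)

end LeavittPathAlgebra

/-! ### Combinatorics of edge lists -/

namespace DirectedGraph

variable {V : Type*} {E : Type*} {G : DirectedGraph V E}

/-! Let `x` be central. Finite sums of vertices are local units, so it suffices to put each `x w` in
the core. Since `x w = w x w`, it is a combination of products `α β*` with both paths starting at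
`w`, and `n` bounds the smaller length of each pair. The proof is by induction on `n`, for all `w`
at once (`mul_vertex_mem_core`).

Inductive step: for a large enough finite set `S` of edges leaving `w`, the idempotent `q = w - ∑ e
e*` kills every nontrivial path involved, so `q x q = t q` for a scalar `t`
(`exists_compression_eq_smul`). Centrality gives `x w = t q + ∑ e (x r(e)) e*`. Here `x r(e) = e* (x
w) e` has a smaller bound, and the core is stable under `m ↦ e m e*`
(`edge_mul_mul_ghost_mem_core`).

Base case: `x w` is a combination of `w`, closed paths and closed ghost paths at `w`. If no closed
path at `w` has an exit, each closed path `d` satisfies `d d* = w = d* d`, so `d` and `d*` are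
normal. If some closed path has an exit, following it many times and then leaving gives a path `η`
that is not a prefix of `d η`. Then `(d η)* x η = 0` by centrality, and this forces the coefficient
of `d` to vanish (`coeff_eq_zero_of_central`). Reading off the coefficient needs degrees and
nonvanishing of scalar multiples of vertices; both come from a concrete representation
(`exists_degree_functional`). -/

theorem endpoint_append (v : V) (l l' : List E) :
    G.endpoint v (l ++ l') = G.endpoint (G.endpoint v l) l' := by
  induction l generalizing v with
  | nil => rfl
  | cons e l ih => exact ih (G.r e)

theorem isPathFrom_append {v : V} {l l' : List E} :
    G.IsPathFrom v (l ++ l') ↔ G.IsPathFrom v l ∧ G.IsPathFrom (G.endpoint v l) l' := by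
  induction l generalizing v with
  | nil => simp [IsPathFrom, endpoint]
  | cons e l ih => simp [IsPathFrom, endpoint, ih, and_assoc]

/-- Nonempty closed paths based at `w`. -/
def closedPaths (G : DirectedGraph V E) (w : V) : Set (List E) :=
  {l | G.IsPathFrom w l ∧ G.endpoint w l = w ∧ l ≠ []}

theorem flatten_replicate_closed {w : V} {c : List E} (hc : G.IsPathFrom w c)
    (hc' : G.endpoint w c = w) (k : ℕ) :
    G.IsPathFrom w (List.replicate k c).flatten ∧
      G.endpoint w (List.replicate k c).flatten = w := by
  induction k with
  | zero => simp [IsPathFrom, endpoint]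
  | succ k ih =>
    rw [List.replicate_succ, List.flatten_cons, isPathFrom_append, endpoint_append, hc']
    exact ⟨⟨hc, ih.1⟩, ih.2⟩

/-- Prepending `d` preserves the prefix relation, so the hypothesis chains with itself. -/
theorem prefix_flatten_replicate_append {d l : List E} (h : l <+: d ++ l) (j : ℕ) :
    l <+: (List.replicate j d).flatten ++ l := by
  induction j with
  | zero => simp
  | succ j ih =>
    rw [List.replicate_succ, List.flatten_cons, List.append_assoc]
    exact h.trans ((List.prefix_append_right_inj d).2 ih)

/-- A path which runs many times around a closed path and then leaves it is not periodic. -/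
theorem not_prefix_of_exit {τ σ d : List E} {f g : E} (hfg : f ≠ g) (hd : d ≠ []) :
    ¬ ((List.replicate d.length (τ ++ g :: σ)).flatten ++ (τ ++ [f]) <+:
      d ++ ((List.replicate d.length (τ ++ g :: σ)).flatten ++ (τ ++ [f]))) := by
  intro h
  set c := τ ++ g :: σ with hc
  -- `c` repeated `|d|` times and `d` repeated `|c|` times have the same length and are prefixes of
  -- one list, hence equal. Cancelling them leaves `τ f` as a prefix of a list beginning with `τ g`.
  have h1 := prefix_flatten_replicate_append h c.length
  have hlen : (List.replicate d.length c).flatten.length =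
      (List.replicate c.length d).flatten.length := by
    simp [mul_comm]
  have h2 : (List.replicate d.length c).flatten = (List.replicate c.length d).flatten :=
    (List.prefix_of_prefix_length_le ((List.prefix_append _ _).trans h1)
      (List.prefix_append _ _) hlen.le).eq_of_length hlen
  rw [← h2, List.prefix_append_right_inj] at h1
  obtain ⟨k, hk⟩ := Nat.exists_eq_succ_of_ne_zero (mt List.length_eq_zero_iff.1 hd)
  rw [hk, List.replicate_succ, List.flatten_cons, hc, List.append_assoc, List.append_assoc,
    List.prefix_append_right_inj, List.cons_append, List.cons_prefix_cons] at h1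
  exact hfg h1.1

end DirectedGraph

namespace LeavittPathAlgebra

open DirectedGraph

variable {V : Type*} {E : Type*} {R : Type*} [CommRing R] {G : DirectedGraph V E}

/-! ### Multiplication rules for paths and ghost paths -/

section Monomial

theorem vertex_mul_monomial {v : V} {l : List E} (h : G.IsPathFrom v l) :
    vertex R G v * monomial R G v l = monomial R G v l := by
  cases l with
  | nil => exact (isLeavittFamily R G).vertex_idem v
  | cons e l =>
    obtain ⟨rfl, -⟩ := h
    rw [monomial, ← mul_assoc, (isLeavittFamily R G).source_edge]

theorem vertex_mul_monomial_of_ne {u v : V} {l : List E} (h : G.IsPathFrom v l) (hu : u ≠ v) :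
    vertex R G u * monomial R G v l = 0 := by
  rw [← vertex_mul_monomial h, ← mul_assoc, (isLeavittFamily R G).vertex_orth u v hu, zero_mul]

theorem monomial_mul_vertex (v : V) (l : List E) :
    monomial R G v l * vertex R G (G.endpoint v l) = monomial R G v l := by
  induction l generalizing v with
  | nil => exact (isLeavittFamily R G).vertex_idem v
  | cons e l ih => rw [monomial, endpoint, mul_assoc, ih]

theorem star_monomial_mul_vertex {v : V} {l : List E} (h : G.IsPathFrom v l) :
    star (monomial R G v l) * vertex R G v = star (monomial R G v l) := by
  simpa using congrArg star (vertex_mul_monomial (R := R) h)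

theorem star_monomial_mul_vertex_of_ne {u v : V} {l : List E} (h : G.IsPathFrom v l)
    (hu : u ≠ v) : star (monomial R G v l) * vertex R G u = 0 := by
  simpa using congrArg star (vertex_mul_monomial_of_ne (R := R) h hu)

theorem vertex_mul_star_monomial (v : V) (l : List E) :
    vertex R G (G.endpoint v l) * star (monomial R G v l) = star (monomial R G v l) := by
  simpa using congrArg star (monomial_mul_vertex (R := R) (G := G) v l)

theorem monomial_append {v : V} {l l' : List E} (h : G.IsPathFrom (G.endpoint v l) l') :
    monomial R G v (l ++ l') = monomial R G v l * monomial R G (G.endpoint v l) l' := by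
  induction l generalizing v with
  | nil => exact (vertex_mul_monomial h).symm
  | cons e l ih => rw [List.cons_append, monomial, ih h, monomial, endpoint, mul_assoc]

theorem star_monomial_mul_self {v : V} {l : List E} (h : G.IsPathFrom v l) :
    star (monomial R G v l) * monomial R G v l = vertex R G (G.endpoint v l) := by
  induction l generalizing v with
  | nil => simpa [monomial, endpoint] using (isLeavittFamily R G).vertex_idem v
  | cons e l ih =>
    rw [monomial, star_mul, star_edge, mul_assoc, ← mul_assoc (ghost R G e),
      (isLeavittFamily R G).ghost_edge_self, vertex_mul_monomial h.2, ih h.2, endpoint]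

theorem monomial_mul_star_mul_self {v : V} {l : List E} (h : G.IsPathFrom v l) :
    monomial R G v l * star (monomial R G v l) * monomial R G v l = monomial R G v l := by
  rw [mul_assoc, star_monomial_mul_self h, monomial_mul_vertex]

theorem ghost_mul_monomial_cons (e : E) {v : V} {l : List E} (h : G.IsPathFrom v (e :: l)) :
    ghost R G e * monomial R G v (e :: l) = monomial R G (G.r e) l := by
  rw [monomial, ← mul_assoc, (isLeavittFamily R G).ghost_edge_self, vertex_mul_monomial h.2]

theorem ghost_mul_monomial_cons_of_ne {e f : E} (hef : e ≠ f) (v : V) (l : List E) :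
    ghost R G e * monomial R G v (f :: l) = 0 := by
  rw [monomial, ← mul_assoc, (isLeavittFamily R G).ghost_edge e f hef, zero_mul]

theorem star_monomial_cons_mul_edge (e : E) {v : V} {l : List E} (h : G.IsPathFrom v (e :: l)) :
    star (monomial R G v (e :: l)) * edge R G e = star (monomial R G (G.r e) l) := by
  simpa using congrArg star (ghost_mul_monomial_cons (R := R) e h)

theorem star_monomial_cons_mul_edge_of_ne {e f : E} (hef : e ≠ f) (v : V) (l : List E) :
    star (monomial R G v (f :: l)) * edge R G e = 0 := by
  simpa using congrArg star (ghost_mul_monomial_cons_of_ne (R := R) (G := G) hef v l)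

/-- Common initial edges cancel by `e* e = r(e)`; incomparable paths then meet at distinct edges,
where `e* f = 0`. -/
theorem star_monomial_mul_eq_zero {v : V} {l l' : List E} (hl : G.IsPathFrom v l)
    (hl' : G.IsPathFrom v l') (h : ¬ l <+: l') (h' : ¬ l' <+: l) :
    star (monomial R G v l) * monomial R G v l' = 0 := by
  induction l generalizing v l' with
  | nil => exact absurd List.nil_prefix h
  | cons e l ih =>
    cases l' with
    | nil => exact absurd List.nil_prefix h'
    | cons f l' =>
      rw [monomial, star_mul, star_edge, mul_assoc]
      by_cases hef : e = f
      · subst hef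
        rw [ghost_mul_monomial_cons e hl']
        simp only [List.cons_prefix_cons, true_and] at h h'
        exact ih hl.2 hl'.2 h h'
      · rw [ghost_mul_monomial_cons_of_ne hef, mul_zero]

theorem edge_eq_monomial (e : E) : edge R G e = monomial R G (G.s e) [e] :=
  ((isLeavittFamily R G).edge_range e).symm

theorem monomial_mul_edge {v : V} {l : List E} {e : E} (h : G.endpoint v l = G.s e) :
    monomial R G v l * edge R G e = monomial R G v (l ++ [e]) := by
  have h' : G.IsPathFrom (G.endpoint v l) [e] := ⟨h.symm, trivial⟩
  rw [monomial_append h', edge_eq_monomial, h]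

/-- If no edge of a path has an exit, then the path is a coisometry. -/
theorem monomial_mul_star_self_of_no_exit {v : V} {l : List E} (h : G.IsPathFrom v l)
    (hl : ∀ g ∈ l, ∀ f, G.s f = G.s g → f = g) :
    monomial R G v l * star (monomial R G v l) = vertex R G v := by
  induction l generalizing v with
  | nil => simpa [monomial] using (isLeavittFamily R G).vertex_idem v
  | cons e l ih =>
    obtain ⟨rfl, hp⟩ := h
    -- The source of `e` is regular and emits `e` alone, so relation (4) reads `s(e) = e e*`.
    have hset : {f : E | G.s f = G.s e} = {e} := by
      ext f
      exact ⟨hl e (by simp) f, fun hf => by rw [hf]; rfl⟩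
    have hreg : G.IsRegular (G.s e) := by
      unfold DirectedGraph.IsRegular
      rw [hset]
      exact ⟨Set.finite_singleton e, Set.singleton_nonempty e⟩
    have hfin : hreg.1.toFinset = {e} := by
      ext f
      simp only [Set.Finite.mem_toFinset, hset, Set.mem_singleton_iff, Finset.mem_singleton]
    rw [(isLeavittFamily R G).vertex_eq_sum _ hreg, hfin, Finset.sum_singleton, monomial,
      star_mul, star_edge, mul_assoc, ← mul_assoc (monomial R G _ l),
      ih hp fun g hg => hl g (List.mem_cons_of_mem _ hg), (isLeavittFamily R G).range_ghost]

end Monomial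

/-! ### Spanning by standard generators, and local units -/

section Span

theorem pathElem_mul_star_mem {α β : G.Path} (h : α.range = β.range) :
    pathElem R α * star (pathElem R β) ∈ Submodule.span R (standardGenerators R G) :=
  Submodule.subset_span ⟨α, β, h, rfl⟩

theorem gen_mem_span (g : Gen V E) :
    mkHom R G (FreeAlg.of R g) ∈ Submodule.span R (standardGenerators R G) := by
  apply Submodule.subset_span
  cases g with
  | vertex v =>
    refine ⟨⟨v, [], trivial⟩, ⟨v, [], trivial⟩, rfl, ?_⟩
    change vertex R G v = vertex R G v * star (vertex R G v)
    rw [star_vertex, (isLeavittFamily R G).vertex_idem]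
  | edge e =>
    refine ⟨⟨G.s e, [e], ⟨rfl, trivial⟩⟩, ⟨G.r e, [], trivial⟩, rfl, ?_⟩
    change edge R G e = (edge R G e * vertex R G (G.r e)) * star (vertex R G (G.r e))
    rw [star_vertex, (isLeavittFamily R G).edge_range, (isLeavittFamily R G).edge_range]
  | ghost e =>
    refine ⟨⟨G.r e, [], trivial⟩, ⟨G.s e, [e], ⟨rfl, trivial⟩⟩, rfl, ?_⟩
    change ghost R G e = vertex R G (G.r e) * star (edge R G e * vertex R G (G.r e))
    rw [(isLeavittFamily R G).edge_range, star_edge, (isLeavittFamily R G).range_ghost]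

/-- A generator on the left lengthens or shortens `α`, kills the product, or, for a ghost edge
meeting a trivial `α`, is absorbed by `e* β* = (β e)*`. Stability under single generators reaches
all words. -/
theorem gen_mul_mem_span (g : Gen V E) {z : LeavittPathAlgebra R G}
    (hz : z ∈ Submodule.span R (standardGenerators R G)) :
    mkHom R G (FreeAlg.of R g) * z ∈ Submodule.span R (standardGenerators R G) := by
  induction hz using Submodule.span_induction with
  | zero => rw [mul_zero]; exact zero_mem _
  | add x y _ _ hx hy => rw [mul_add]; exact add_mem hx hy
  | smul t x _ hx => rw [mul_smul_comm]; exact Submodule.smul_mem _ t hx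
  | mem z hz =>
    obtain ⟨⟨u, α, hα⟩, ⟨v, β, hβ⟩, hr, rfl⟩ := hz
    change G.endpoint u α = G.endpoint v β at hr
    change _ * (monomial R G u α * star (monomial R G v β)) ∈ _
    rw [← mul_assoc]
    cases g with
    | vertex w =>
      change vertex R G w * _ * _ ∈ _
      by_cases hw : w = u
      · subst hw
        rw [vertex_mul_monomial hα]
        exact pathElem_mul_star_mem (α := ⟨w, α, hα⟩) (β := ⟨v, β, hβ⟩) hr
      · rw [vertex_mul_monomial_of_ne hα hw, zero_mul]
        exact zero_mem _
    | edge e =>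
      change edge R G e * _ * _ ∈ _
      by_cases hw : G.r e = u
      · subst hw
        exact pathElem_mul_star_mem (α := ⟨G.s e, e :: α, ⟨rfl, hα⟩⟩) (β := ⟨v, β, hβ⟩) hr
      · rw [← (isLeavittFamily R G).edge_range, mul_assoc (edge R G e),
          vertex_mul_monomial_of_ne hα hw, mul_zero, zero_mul]
        exact zero_mem _
    | ghost e =>
      change ghost R G e * _ * _ ∈ _
      cases α with
      | nil =>
        by_cases hw : G.s e = u
        · subst hw
          have hr' : G.endpoint v β = G.s e := hr.symm
          have key : ghost R G e * monomial R G (G.s e) [] * star (monomial R G v β) =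
              monomial R G (G.r e) [] * star (monomial R G v (β ++ [e])) := by
            rw [← monomial_mul_edge hr', star_mul, star_edge, ← mul_assoc]
            simp only [monomial]
            rw [(isLeavittFamily R G).ghost_source, (isLeavittFamily R G).range_ghost]
          rw [key]
          refine pathElem_mul_star_mem (α := ⟨G.r e, [], trivial⟩)
            (β := ⟨v, β ++ [e], isPathFrom_append.2 ⟨hβ, hr'.symm, trivial⟩⟩) ?_
          simp [Path.range, endpoint_append, endpoint]
        · rw [← (isLeavittFamily R G).ghost_source, mul_assoc (ghost R G e), monomial,
            (isLeavittFamily R G).vertex_orth _ _ hw, mul_zero, zero_mul]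
          exact zero_mem _
      | cons f α =>
        by_cases hef : e = f
        · subst hef
          rw [ghost_mul_monomial_cons e hα]
          exact pathElem_mul_star_mem (α := ⟨G.r e, α, hα.2⟩) (β := ⟨v, β, hβ⟩) hr
        · rw [ghost_mul_monomial_cons_of_ne hef, zero_mul]
          exact zero_mem _

/-- The standard generators span the Leavitt path algebra. -/
theorem mem_span_standardGenerators (x : LeavittPathAlgebra R G) :
    x ∈ Submodule.span R (standardGenerators R G) := by
  have word : ∀ m : FreeSemigroup (Gen V E),
      mkHom R G (MonoidAlgebra.single m 1) ∈ Submodule.span R (standardGenerators R G) := by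
    intro m
    induction m using FreeSemigroup.recOnMul with
    | ih1 g => exact gen_mem_span g
    | ih2 g m _ hm =>
      have : (MonoidAlgebra.single (FreeSemigroup.of g * m) 1 : FreeAlg R V E) =
          FreeAlg.of R g * MonoidAlgebra.single m 1 := by
        rw [FreeAlg.of, MonoidAlgebra.single_mul_single, one_mul]
      rw [this, map_mul]
      exact gen_mul_mem_span g hm
  obtain ⟨a, rfl⟩ := mk_surjective x
  change mkHom R G a ∈ _
  induction a using MonoidAlgebra.induction_linear with
  | zero => rw [map_zero]; exact zero_mem _
  | add f g hf hg => rw [map_add]; exact add_mem hf hg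
  | single m t =>
    have : (MonoidAlgebra.single m t : FreeAlg R V E) = t • MonoidAlgebra.single m 1 := by
      rw [MonoidAlgebra.smul_single, smul_eq_mul, mul_one]
    rw [this, map_smul]
    exact Submodule.smul_mem _ t (word m)

/-- Finite sums of vertices are local units. -/
theorem exists_sum_mul_vertex_eq (x : LeavittPathAlgebra R G) :
    ∃ F : Finset V, ∀ F', F ⊆ F' → ∑ w ∈ F', x * vertex R G w = x := by
  classical
  induction mem_span_standardGenerators x using Submodule.span_induction with
  | zero => exact ⟨∅, fun F' _ => by simp⟩
  | add x y _ _ hx hy =>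
    obtain ⟨F, hF⟩ := hx
    obtain ⟨F₂, hF₂⟩ := hy
    refine ⟨F ∪ F₂, fun F' h => ?_⟩
    simp only [add_mul, Finset.sum_add_distrib]
    rw [hF F' (Finset.union_subset_left h), hF₂ F' (Finset.union_subset_right h)]
  | smul t x _ hx =>
    obtain ⟨F, hF⟩ := hx
    refine ⟨F, fun F' h => ?_⟩
    simp only [smul_mul_assoc]
    rw [← Finset.smul_sum, hF F' h]
  | mem z hz =>
    obtain ⟨α, ⟨v, β, hβ⟩, hr, rfl⟩ := hz
    refine ⟨{v}, fun F' h => ?_⟩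
    rw [Finset.sum_eq_single v]
    · rw [mul_assoc]
      exact congrArg _ (star_monomial_mul_vertex hβ)
    · intro w _ hw
      rw [mul_assoc]
      exact (congrArg _ (star_monomial_mul_vertex_of_ne hβ hw)).trans (mul_zero _)
    · intro hv
      exact absurd (h (Finset.mem_singleton_self v)) hv

end Span

/-! ### Elements and stability of the commutative core -/

section Core

/-- For `x = α β*` one has `x x* = α α*` and `x* x = β β*`, so normality amounts to equality of
these two projections. -/
theorem monomial_mul_star_mem_core {u v : V} {α β : List E} (hα : G.IsPathFrom u α)
    (hβ : G.IsPathFrom v β) (hr : G.endpoint u α = G.endpoint v β)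
    (h : monomial R G u α * star (monomial R G u α) =
      monomial R G v β * star (monomial R G v β)) :
    monomial R G u α * star (monomial R G v β) ∈ commutativeCore R G := by
  refine NonUnitalAlgebra.subset_adjoin R ⟨⟨⟨u, α, hα⟩, ⟨v, β, hβ⟩, hr, rfl⟩, ?_⟩
  rw [star_mul, star_star, mul_assoc, ← mul_assoc (star _), star_monomial_mul_self hβ, ← hr,
    ← mul_assoc, monomial_mul_vertex, h, mul_assoc (monomial R G v β), ← mul_assoc (star _),
    star_monomial_mul_self hα, hr, vertex_mul_star_monomial]

theorem vertex_mem_core (v : V) : vertex R G v ∈ commutativeCore R G := by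
  have := monomial_mul_star_mem_core (R := R) (G := G) (u := v) (v := v) (α := []) (β := [])
    trivial trivial rfl rfl
  rwa [monomial, star_vertex, (isLeavittFamily R G).vertex_idem] at this

theorem edge_mul_ghost_mem_core (e : E) : edge R G e * ghost R G e ∈ commutativeCore R G := by
  have := monomial_mul_star_mem_core (R := R) (G := G) (u := G.s e) (v := G.s e)
    (α := [e]) (β := [e]) ⟨rfl, trivial⟩ ⟨rfl, trivial⟩ rfl rfl
  rwa [← edge_eq_monomial, star_edge] at this

/-- Needed to make conjugation by an edge multiplicative on the core. -/
theorem vertex_comm_of_mem_core (w : V) {m : LeavittPathAlgebra R G}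
    (hm : m ∈ commutativeCore R G) : vertex R G w * m = m * vertex R G w := by
  induction hm using NonUnitalAlgebra.adjoin_induction with
  | zero => rw [mul_zero, zero_mul]
  | add x y _ _ hx hy => rw [mul_add, add_mul, hx, hy]
  | smul t x _ hx => rw [mul_smul_comm, smul_mul_assoc, hx]
  | mul x y _ _ hx hy => rw [← mul_assoc, hx, mul_assoc, hy, mul_assoc]
  | mem z hz =>
    obtain ⟨⟨⟨u, α, hα⟩, ⟨v, β, hβ⟩, hr, rfl⟩, hn⟩ := hz
    change G.endpoint u α = G.endpoint v β at hr
    simp only [pathElem] at hn ⊢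
    by_cases huv : u = v
    · subst huv
      by_cases hw : w = u
      · subst hw
        rw [← mul_assoc, vertex_mul_monomial hα, mul_assoc, star_monomial_mul_vertex hβ]
      · rw [← mul_assoc, vertex_mul_monomial_of_ne hα hw, mul_assoc,
          star_monomial_mul_vertex_of_ne hβ hw, zero_mul, mul_zero]
    -- A normal generator with distinct sources is zero: `α α* = β β*` is fixed by `u` on the left
    -- and also killed by it, so `α = α α* α = 0`.
    · suffices h0 : monomial R G u α = 0 by rw [h0]; simp
      have h1 : vertex R G u * (monomial R G u α * star (monomial R G u α)) =
          monomial R G u α * star (monomial R G u α) := by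
        rw [← mul_assoc, vertex_mul_monomial hα]
      have h2 : vertex R G u * (monomial R G v β * star (monomial R G v β)) = 0 := by
        rw [← mul_assoc, vertex_mul_monomial_of_ne hβ huv, zero_mul]
      rw [star_mul, star_star, mul_assoc, ← mul_assoc (star _), star_monomial_mul_self hβ, ← hr,
        ← mul_assoc, monomial_mul_vertex, mul_assoc (monomial R G v β), ← mul_assoc (star _),
        star_monomial_mul_self hα, hr, vertex_mul_star_monomial] at hn
      rw [hn, h2, ← hn] at h1
      rw [← monomial_mul_star_mul_self hα, ← h1, zero_mul]

/-- The commutative core is stable under conjugation by edges. -/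
theorem edge_mul_mul_ghost_mem_core (e : E) {m : LeavittPathAlgebra R G}
    (hm : m ∈ commutativeCore R G) : edge R G e * m * ghost R G e ∈ commutativeCore R G := by
  induction hm using NonUnitalAlgebra.adjoin_induction with
  | zero => rw [mul_zero, zero_mul]; exact zero_mem _
  | add x y _ _ hx hy => rw [mul_add, add_mul]; exact add_mem hx hy
  | smul t x _ hx =>
    rw [mul_smul_comm, smul_mul_assoc]
    exact SMulMemClass.smul_mem t hx
  | mul x y hx' _ hx hy =>
    -- The inner `e* e = r(e)` moves left past `x`, which lies in the core, and is absorbed by `e`.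
    have : edge R G e * (x * y) * ghost R G e =
        (edge R G e * x * ghost R G e) * (edge R G e * y * ghost R G e) := by
      have h1 : (edge R G e * x * ghost R G e) * (edge R G e * y * ghost R G e) =
          edge R G e * (x * (ghost R G e * edge R G e)) * y * ghost R G e := by
        simp only [mul_assoc]
      rw [h1, (isLeavittFamily R G).ghost_edge_self, ← vertex_comm_of_mem_core _ hx',
        ← mul_assoc (edge R G e) (vertex R G _), (isLeavittFamily R G).edge_range,
        ← mul_assoc (edge R G e)]
    rw [this]
    exact mul_mem hx hy
  | mem z hz =>
    have hcomm := vertex_comm_of_mem_core (G.r e) (NonUnitalAlgebra.subset_adjoin R hz)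
    obtain ⟨⟨⟨u, α, hα⟩, ⟨v, β, hβ⟩, hr, rfl⟩, hn⟩ := hz
    change G.endpoint u α = G.endpoint v β at hr
    simp only [pathElem] at hn hcomm ⊢
    by_cases hu : G.r e = u
    · by_cases hv : G.r e = v
      · subst hu
        subst hv
        -- Conjugating `α α* = β β*` by `e` shows that `(e α)(e β)*` is again normal. In the other
        -- cases the product vanishes.
        have := monomial_mul_star_mem_core (R := R) (u := G.s e) (v := G.s e) (α := e :: α)
          (β := e :: β) ⟨rfl, hα⟩ ⟨rfl, hβ⟩ hr (by
            rw [star_mul, star_star, mul_assoc, ← mul_assoc (star _), star_monomial_mul_self hβ,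
              ← hr, ← mul_assoc, monomial_mul_vertex, mul_assoc (monomial R G _ β),
              ← mul_assoc (star _), star_monomial_mul_self hα, hr, vertex_mul_star_monomial] at hn
            simp only [monomial, star_mul, mul_assoc]
            rw [← mul_assoc (monomial R G _ α), hn, ← mul_assoc (monomial R G _ β)])
        simpa only [monomial, star_mul, star_edge, mul_assoc] using this
      · rw [← (isLeavittFamily R G).range_ghost e, ← mul_assoc, mul_assoc (edge R G e),
          mul_assoc (monomial R G u α), star_monomial_mul_vertex_of_ne hβ hv]
        simp
    · rw [← (isLeavittFamily R G).edge_range e, mul_assoc (edge R G e),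
        ← mul_assoc (vertex R G _), vertex_mul_monomial_of_ne hα hu]
      simp

end Core

/-! ### A graded representation by shifts -/

section Representation

/-- The infinite set on whose copies, one at each vertex and in each degree, the edges act as
shifts. -/
abbrev ShiftSpace (E : Type*) := ℕ ⊕ E

/-- At each vertex which is not a sink, pairs of an outgoing edge and a point can be coded by
points. -/
theorem exists_shift [Nonempty E] (G : DirectedGraph V E) :
    ∃ (φ : E → ShiftSpace E → ShiftSpace E) (ψ : V → ShiftSpace E → E × ShiftSpace E),
      (∀ e x, ψ (G.s e) (φ e x) = (e, x)) ∧
      ∀ e x, G.s (ψ (G.s e) x).1 = G.s e ∧ φ (ψ (G.s e) x).1 (ψ (G.s e) x).2 = x := by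
  classical
  have key : ∀ v : V, Nonempty {e : E // G.s e = v} →
      Nonempty ({e : E // G.s e = v} × ShiftSpace E ≃ ShiftSpace E) := by
    intro v hv
    -- `ℕ ⊕ E` is infinite and at least as large as the nonempty set of outgoing edges, so the
    -- product has its cardinality.
    rw [← Cardinal.eq, Cardinal.mk_prod, Cardinal.lift_id, Cardinal.lift_id]
    refine Cardinal.mul_eq_right (Cardinal.aleph0_le_mk _) ?_ ?_
    · exact (Cardinal.mk_subtype_le _).trans (Cardinal.mk_le_of_injective Sum.inr_injective)
    · exact Cardinal.mk_ne_zero_iff.2 hv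
  have key' : ∀ e : E, Nonempty {f : E // G.s f = G.s e} := fun e => ⟨⟨e, rfl⟩⟩
  let θ : ∀ v : V, Nonempty {e : E // G.s e = v} →
      ({e : E // G.s e = v} × ShiftSpace E ≃ ShiftSpace E) := fun v h => (key v h).some
  let φ : E → ShiftSpace E → ShiftSpace E := fun e x => θ (G.s e) (key' e) (⟨e, rfl⟩, x)
  have hφ : ∀ v (h : Nonempty {e : E // G.s e = v}) (f : {e : E // G.s e = v}) x,
      φ f x = θ v h (f, x) := by
    rintro v h ⟨f, rfl⟩ x
    rfl
  -- The value at a sink is arbitrary: only vertices of the form `s(e)` matter.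
  let ψ : V → ShiftSpace E → E × ShiftSpace E := fun v x =>
    if h : Nonempty {e : E // G.s e = v} then
      (((θ v h).symm x).1, ((θ v h).symm x).2) else (Classical.arbitrary E, x)
  have hψ : ∀ e x, ψ (G.s e) x =
      (((θ _ (key' e)).symm x).1.1, ((θ _ (key' e)).symm x).2) := fun e x =>
    dif_pos (key' e)
  refine ⟨φ, ψ, fun e x => ?_, fun e x => ?_⟩
  · rw [hψ]
    simp [φ]
  · rw [hψ]
    refine ⟨((θ _ (key' e)).symm x).1.2, ?_⟩
    change φ ((θ _ (key' e)).symm x).1 ((θ _ (key' e)).symm x).2 = x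
    rw [hφ _ (key' e)]
    exact (θ _ (key' e)).apply_symm_apply x

/-- The free module on the points at the vertices, in all degrees. -/
abbrev ShiftModule (R : Type*) [CommRing R] (V : Type*) (E : Type*) :=
  (V × ShiftSpace E × ℤ) →₀ R

open scoped Classical in
/-- Projection onto the points at `v`. -/
noncomputable def vertexOp (R : Type*) [CommRing R] {V : Type*} (E : Type*) (v : V) :
    Module.End R (ShiftModule R V E) :=
  Finsupp.linearCombination R fun w => if w.1 = v then Finsupp.single w 1 else 0

open scoped Classical in
/-- The shift from the points at `r(e)` to the points at `s(e)`. -/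
noncomputable def edgeOp (R : Type*) [CommRing R] (G : DirectedGraph V E)
    (φ : E → ShiftSpace E → ShiftSpace E) (e : E) : Module.End R (ShiftModule R V E) :=
  Finsupp.linearCombination R fun w =>
    if w.1 = G.r e then Finsupp.single (G.s e, φ e w.2.1, w.2.2 + 1) 1 else 0

open scoped Classical in
/-- The shift from the points at `s(e)` to the points at `r(e)`. -/
noncomputable def ghostOp (R : Type*) [CommRing R] (G : DirectedGraph V E)
    (ψ : V → ShiftSpace E → E × ShiftSpace E) (e : E) : Module.End R (ShiftModule R V E) :=
  Finsupp.linearCombination R fun w =>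
    if w.1 = G.s e ∧ (ψ (G.s e) w.2.1).1 = e then
      Finsupp.single (G.r e, (ψ (G.s e) w.2.1).2, w.2.2 - 1) 1 else 0

open scoped Classical in
theorem vertexOp_single (v : V) (w : V × ShiftSpace E × ℤ) :
    vertexOp R E v (Finsupp.single w 1) = if w.1 = v then Finsupp.single w 1 else 0 := by
  simp [vertexOp]

open scoped Classical in
theorem edgeOp_single (φ : E → ShiftSpace E → ShiftSpace E) (e : E)
    (w : V × ShiftSpace E × ℤ) :
    edgeOp R G φ e (Finsupp.single w 1) =
      if w.1 = G.r e then Finsupp.single (G.s e, φ e w.2.1, w.2.2 + 1) 1 else 0 := by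
  simp [edgeOp]

open scoped Classical in
theorem ghostOp_single (ψ : V → ShiftSpace E → E × ShiftSpace E) (e : E)
    (w : V × ShiftSpace E × ℤ) :
    ghostOp R G ψ e (Finsupp.single w 1) =
      if w.1 = G.s e ∧ (ψ (G.s e) w.2.1).1 = e then
        Finsupp.single (G.r e, (ψ (G.s e) w.2.1).2, w.2.2 - 1) 1 else 0 := by
  simp [ghostOp]

theorem shiftModule_end_ext {a b : Module.End R (ShiftModule R V E)}
    (h : ∀ w, a (Finsupp.single w 1) = b (Finsupp.single w 1)) : a = b :=
  Finsupp.lhom_ext' fun w => LinearMap.ext_ring (h w)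

/-- `h1` makes the maps `φ e` injective, with disjoint images for distinct edges of common source;
this yields relation (3). By `h2` these images cover all points at a non-sink, which yields relation
(4). -/
theorem isLeavittFamily_shift {φ : E → ShiftSpace E → ShiftSpace E}
    {ψ : V → ShiftSpace E → E × ShiftSpace E} (h1 : ∀ e x, ψ (G.s e) (φ e x) = (e, x))
    (h2 : ∀ e x, G.s (ψ (G.s e) x).1 = G.s e ∧ φ (ψ (G.s e) x).1 (ψ (G.s e) x).2 = x) :
    IsLeavittFamily G (vertexOp R E) (edgeOp R G φ) (ghostOp R G ψ) where
  vertex_idem v := shiftModule_end_ext fun w => by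
    by_cases hw : w.1 = v <;> simp [vertexOp_single, hw]
  vertex_orth v v' h := shiftModule_end_ext fun w => by
    by_cases hw : w.1 = v' <;> simp [vertexOp_single, hw, h.symm]
  source_edge e := shiftModule_end_ext fun w => by
    by_cases hw : w.1 = G.r e <;> simp [vertexOp_single, edgeOp_single, hw]
  edge_range e := shiftModule_end_ext fun w => by
    by_cases hw : w.1 = G.r e <;> simp [vertexOp_single, edgeOp_single, hw]
  range_ghost e := shiftModule_end_ext fun w => by
    by_cases hw : w.1 = G.s e ∧ (ψ (G.s e) w.2.1).1 = e <;>
      simp [vertexOp_single, ghostOp_single, hw]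
  ghost_source e := shiftModule_end_ext fun w => by
    by_cases hw : w.1 = G.s e <;> simp [vertexOp_single, ghostOp_single, hw]
  ghost_edge_self e := shiftModule_end_ext fun w => by
    obtain ⟨u, x, n⟩ := w
    by_cases hw : u = G.r e
    · subst hw
      simp [vertexOp_single, edgeOp_single, ghostOp_single, h1]
    · simp [vertexOp_single, edgeOp_single, hw]
  ghost_edge e f h := shiftModule_end_ext fun w => by
    obtain ⟨u, x, n⟩ := w
    by_cases hw : u = G.r f
    · by_cases hs : G.s f = G.s e
      · simp [edgeOp_single, ghostOp_single, hw, hs]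
        intro h'
        rw [← hs, h1] at h'
        exact absurd h'.symm h
      · simp [edgeOp_single, ghostOp_single, hw, hs]
    · simp [edgeOp_single, hw]
  vertex_eq_sum v h := shiftModule_end_ext fun w => by
    classical
    obtain ⟨u, x, n⟩ := w
    rw [LinearMap.sum_apply]
    simp only [Module.End.mul_apply, ghostOp_single, vertexOp_single]
    by_cases hu : u = v
    · subst hu
      obtain ⟨e, rfl⟩ : ∃ e, G.s e = u := h.2
      rw [Finset.sum_eq_single (ψ (G.s e) x).1]
      · simp [edgeOp_single, h2]
      · intro f hf hfx
        have hf' : G.s f = G.s e := by simpa using hf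
        rw [if_neg, map_zero]
        rintro ⟨-, h'⟩
        rw [hf'] at h'
        exact hfx h'.symm
      · intro hn
        rw [Set.Finite.mem_toFinset] at hn
        exact absurd (h2 e x).1 hn
    · rw [if_neg hu, Finset.sum_eq_zero]
      intro f hf
      have hf' : G.s f = v := by simpa using hf
      rw [if_neg, map_zero]
      rintro ⟨h', -⟩
      exact hu (h'.trans hf')

/-- There are submodules behaving like the homogeneous components of the grading by length, and a
linear functional with value `1` at a given vertex which vanishes in all nonzero degrees. -/
theorem exists_degree_functional [Nonempty E] (R : Type*) [CommRing R] (G : DirectedGraph V E)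
    (v : V) :
    ∃ (D : ℤ → Submodule R (LeavittPathAlgebra R G)) (T : LeavittPathAlgebra R G →ₗ[R] R),
      (∀ w, vertex R G w ∈ D 0) ∧ (∀ e, edge R G e ∈ D 1) ∧ (∀ e, ghost R G e ∈ D (-1)) ∧
      (∀ m n x y, x ∈ D m → y ∈ D n → x * y ∈ D (m + n)) ∧
      T (vertex R G v) = 1 ∧ ∀ n x, x ∈ D n → n ≠ 0 → T x = 0 := by
  classical
  obtain ⟨φ, ψ, h1, h2⟩ := exists_shift G
  let ρ : LeavittPathAlgebra R G →ₙₐ[R] Module.End R (ShiftModule R V E) :=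
    lift (isLeavittFamily_shift h1 h2)
  let U : ℤ → Submodule R (ShiftModule R V E) := fun k => Finsupp.supported R R {w | w.2.2 = k}
  -- `D n` collects the elements acting as operators that raise degree by `n`; independence of these
  -- submodules is never needed.
  let D : ℤ → Submodule R (LeavittPathAlgebra R G) := fun n =>
    { carrier := {z | ∀ k, ∀ u ∈ U k, ρ z u ∈ U (k + n)}
      zero_mem' := fun k u _ => by simp
      add_mem' := fun {a b} ha hb k u hu => by
        rw [map_add]
        exact add_mem (ha k u hu) (hb k u hu)
      smul_mem' := fun t a ha k u hu => by
        rw [map_smul]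
        exact Submodule.smul_mem _ t (ha k u hu) }
  have hD : ∀ n z, (∀ w, ρ z (Finsupp.single w 1) ∈ U (w.2.2 + n)) → z ∈ D n := by
    intro n z hz k u hu
    have hu' : u ∈ Submodule.span R ((fun w => Finsupp.single w (1 : R)) ''
        {w : V × ShiftSpace E × ℤ | w.2.2 = k}) := by
      rwa [← Finsupp.supported_eq_span_single]
    induction hu' using Submodule.span_induction with
    | zero => rw [map_zero]; exact zero_mem _
    | add x y hx hy ihx ihy =>
      rw [← Finsupp.supported_eq_span_single] at hx hy
      rw [map_add]
      exact add_mem (ihx hx) (ihy hy)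
    | smul t x hx ih =>
      rw [← Finsupp.supported_eq_span_single] at hx
      rw [map_smul]
      exact Submodule.smul_mem _ t (ih hx)
    | mem x hx =>
      obtain ⟨w, rfl, rfl⟩ := hx
      exact hz w
  have hsingle : ∀ (w : V × ShiftSpace E × ℤ) k, w.2.2 = k →
      (Finsupp.single w 1 : ShiftModule R V E) ∈ U k := fun w k hw =>
    Finsupp.single_mem_supported R 1 hw
  have hv : ∀ w, ρ (vertex R G w) = vertexOp R E w := lift_vertex _
  have he : ∀ e, ρ (edge R G e) = edgeOp R G φ e := lift_edge _
  have hg : ∀ e, ρ (ghost R G e) = ghostOp R G ψ e := lift_ghost _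
  -- A diagonal matrix coefficient at a point of degree `0` at `v`: `v` fixes this point, and an
  -- element of `D n` sends it into degree `n`.
  let T : LeavittPathAlgebra R G →ₗ[R] R :=
    { toFun := fun z => ρ z (Finsupp.single (v, Sum.inl 0, 0) 1) (v, Sum.inl 0, 0)
      map_add' := fun a b => by simp
      map_smul' := fun t a => by simp }
  refine ⟨D, T, fun w => hD _ _ fun u => ?_, fun e => hD _ _ fun u => ?_,
    fun e => hD _ _ fun u => ?_, fun m n x y hx hy k u hu => ?_, ?_, fun n x hx hn => ?_⟩
  · rw [hv, vertexOp_single]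
    split_ifs
    · exact hsingle _ _ (add_zero _).symm
    · exact zero_mem _
  · rw [he, edgeOp_single]
    split_ifs
    · exact hsingle _ _ rfl
    · exact zero_mem _
  · rw [hg, ghostOp_single]
    split_ifs
    · exact hsingle _ _ rfl
    · exact zero_mem _
  · rw [map_mul, Module.End.mul_apply, show k + (m + n) = k + n + m by ring]
    exact hx _ _ (hy _ _ hu)
  · change ρ (vertex R G v) _ _ = 1
    rw [hv, vertexOp_single, if_pos rfl, Finsupp.single_eq_same]
  · have h := hx 0 _ (hsingle (v, Sum.inl 0, 0) 0 rfl)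
    rw [Finsupp.mem_supported'] at h
    exact h _ fun h0 => hn (by simpa using h0.symm)

end Representation

/-! ### Bounding the shorter path -/

/-- The span of the products `α β*` of paths starting at `w`, one of which has length at
most `n`. -/
noncomputable def shortSpan (R : Type*) [CommRing R] (G : DirectedGraph V E) (n : ℕ) (w : V) :
    Submodule R (LeavittPathAlgebra R G) :=
  Submodule.span R {z | ∃ α β, G.IsPathFrom w α ∧ G.IsPathFrom w β ∧
    G.endpoint w α = G.endpoint w β ∧ min α.length β.length ≤ n ∧
    z = monomial R G w α * star (monomial R G w β)}

theorem shortSpan_mono {m n : ℕ} (h : m ≤ n) (w : V) : shortSpan R G m w ≤ shortSpan R G n w :=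
  Submodule.span_mono fun _ ⟨α, β, hα, hβ, hr, hm, hz⟩ => ⟨α, β, hα, hβ, hr, hm.trans h, hz⟩

/-- Compression by `w` keeps only the products `α β*` whose two paths start at `w`, and finitely
many occur. -/
theorem exists_mem_shortSpan (x : LeavittPathAlgebra R G) (w : V) :
    ∃ n, vertex R G w * x * vertex R G w ∈ shortSpan R G n w := by
  induction mem_span_standardGenerators x using Submodule.span_induction with
  | zero => exact ⟨0, by simp⟩
  | add x y _ _ hx hy =>
    obtain ⟨m, hm⟩ := hx
    obtain ⟨n, hn⟩ := hy
    refine ⟨max m n, ?_⟩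
    rw [mul_add, add_mul]
    exact add_mem (shortSpan_mono (le_max_left m n) w hm) (shortSpan_mono (le_max_right m n) w hn)
  | smul t x _ hx =>
    obtain ⟨n, hn⟩ := hx
    refine ⟨n, ?_⟩
    rw [mul_smul_comm, smul_mul_assoc]
    exact Submodule.smul_mem _ t hn
  | mem z hz =>
    obtain ⟨⟨u, α, hα⟩, ⟨v, β, hβ⟩, hr, rfl⟩ := hz
    change G.endpoint u α = G.endpoint v β at hr
    simp only [pathElem]
    by_cases hu : w = u
    · by_cases hv : w = v
      · subst hu
        subst hv
        refine ⟨min α.length β.length, ?_⟩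
        rw [← mul_assoc, vertex_mul_monomial hα, mul_assoc, star_monomial_mul_vertex hβ]
        exact Submodule.subset_span ⟨α, β, hα, hβ, hr, le_rfl, rfl⟩
      · refine ⟨0, ?_⟩
        rw [← mul_assoc, mul_assoc, star_monomial_mul_vertex_of_ne hβ hv, mul_zero]
        exact zero_mem _
    · refine ⟨0, ?_⟩
      rw [← mul_assoc, vertex_mul_monomial_of_ne hα hu, zero_mul, zero_mul]
      exact zero_mem _

/-- Compressing by an edge shortens the paths. -/
theorem ghost_mul_mul_edge_mem_shortSpan {n : ℕ} (e : E) {z : LeavittPathAlgebra R G}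
    (hz : z ∈ shortSpan R G (n + 1) (G.s e)) :
    ghost R G e * z * edge R G e ∈ shortSpan R G n (G.r e) := by
  induction hz using Submodule.span_induction with
  | zero => rw [mul_zero, zero_mul]; exact zero_mem _
  | add x y _ _ hx hy => rw [mul_add, add_mul]; exact add_mem hx hy
  | smul t x _ hx =>
    rw [mul_smul_comm, smul_mul_assoc]
    exact Submodule.smul_mem _ t hx
  | mem z hz =>
    obtain ⟨α, β, hα, hβ, hr, hm, rfl⟩ := hz
    rw [← mul_assoc, mul_assoc]
    have hnil : ghost R G e * monomial R G (G.s e) [] = ghost R G e :=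
      (isLeavittFamily R G).ghost_source e
    have hnil' : star (monomial R G (G.s e) []) * edge R G e = edge R G e := by
      rw [monomial, star_vertex, (isLeavittFamily R G).source_edge]
    have hv : star (vertex R G (G.r e)) = vertex R G (G.r e) := star_vertex _
    cases α with
    | nil =>
      rw [hnil]
      cases β with
      | nil =>
        rw [hnil', (isLeavittFamily R G).ghost_edge_self]
        refine Submodule.subset_span ⟨[], [], trivial, trivial, rfl, by simp, ?_⟩
        rw [monomial, hv, (isLeavittFamily R G).vertex_idem]
      | cons f β =>
        by_cases hef : e = f
        · subst hef
          rw [star_monomial_cons_mul_edge e hβ]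
          -- Here the compression only rotates a closed path: `e* (e β)* e = (β e)*`. Its length
          -- does not drop, which is why the minimum of the two lengths is bounded and not the
          -- maximum.
          have hr' : G.endpoint (G.r e) β = G.s e := hr.symm
          refine Submodule.subset_span ⟨[], β ++ [e], trivial,
            isPathFrom_append.2 ⟨hβ.2, hr'.symm, trivial⟩, ?_, by simp, ?_⟩
          · rw [endpoint_append]; rfl
          · rw [← monomial_mul_edge hr', star_mul, star_edge, ← mul_assoc, monomial,
              (isLeavittFamily R G).range_ghost]
        · rw [star_monomial_cons_mul_edge_of_ne hef, mul_zero]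
          exact zero_mem _
    | cons f α =>
      by_cases hef : e = f
      · subst hef
        rw [ghost_mul_monomial_cons e hα]
        cases β with
        | nil =>
          have hr' : G.endpoint (G.r e) α = G.s e := hr
          rw [hnil']
          refine Submodule.subset_span ⟨α ++ [e], [],
            isPathFrom_append.2 ⟨hα.2, hr'.symm, trivial⟩, trivial, ?_, by simp, ?_⟩
          · rw [endpoint_append]; rfl
          · rw [← monomial_mul_edge hr', monomial, hv, mul_assoc,
              (isLeavittFamily R G).edge_range]
        | cons f β =>
          by_cases hef : e = f
          · subst hef
            rw [star_monomial_cons_mul_edge e hβ]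
            refine Submodule.subset_span ⟨α, β, hα.2, hβ.2, hr, ?_, rfl⟩
            simp only [List.length_cons] at hm
            omega
          · rw [star_monomial_cons_mul_edge_of_ne hef, mul_zero]
            exact zero_mem _
      · rw [ghost_mul_monomial_cons_of_ne hef, zero_mul]
        exact zero_mem _

/-! ### Cutting down by finitely many edges -/

section Compression

/-- The idempotent `w - ∑ e e*` for a finite set of edges. -/
noncomputable def complementIdem (R : Type*) [CommRing R] (G : DirectedGraph V E) (w : V)
    (S : Finset E) : LeavittPathAlgebra R G :=
  vertex R G w - ∑ e ∈ S, edge R G e * ghost R G e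

theorem complementIdem_mem_core (w : V) (S : Finset E) :
    complementIdem R G w S ∈ commutativeCore R G :=
  sub_mem (vertex_mem_core w) (sum_mem fun e _ => edge_mul_ghost_mem_core e)

theorem star_complementIdem (w : V) (S : Finset E) :
    star (complementIdem R G w S) = complementIdem R G w S := by
  simp [complementIdem, star_sum]

variable {w : V} {S : Finset E}

theorem complementIdem_mul_edge (hS : ∀ e ∈ S, G.s e = w) {e : E} (he : e ∈ S) :
    complementIdem R G w S * edge R G e = 0 := by
  rw [complementIdem, sub_mul, Finset.sum_mul, Finset.sum_eq_single_of_mem e he]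
  · rw [mul_assoc, (isLeavittFamily R G).ghost_edge_self, (isLeavittFamily R G).edge_range,
      ← hS e he, (isLeavittFamily R G).source_edge, sub_self]
  · intro f _ hf
    rw [mul_assoc, (isLeavittFamily R G).ghost_edge f e hf, mul_zero]

theorem complementIdem_mul_monomial (hS : ∀ e ∈ S, G.s e = w) {e : E} (he : e ∈ S) (v : V)
    (l : List E) : complementIdem R G w S * monomial R G v (e :: l) = 0 := by
  rw [monomial, ← mul_assoc, complementIdem_mul_edge hS he, zero_mul]

theorem star_monomial_mul_complementIdem (hS : ∀ e ∈ S, G.s e = w) {e : E} (he : e ∈ S) (v : V)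
    (l : List E) : star (monomial R G v (e :: l)) * complementIdem R G w S = 0 := by
  simpa [star_complementIdem] using congrArg star (complementIdem_mul_monomial (R := R) hS he v l)

theorem complementIdem_mul_vertex (hS : ∀ e ∈ S, G.s e = w) :
    complementIdem R G w S * vertex R G w = complementIdem R G w S := by
  rw [complementIdem, sub_mul, (isLeavittFamily R G).vertex_idem, Finset.sum_mul]
  congr 1
  refine Finset.sum_congr rfl fun e he => ?_
  rw [mul_assoc, ← hS e he, (isLeavittFamily R G).ghost_source]

theorem vertex_mul_complementIdem (hS : ∀ e ∈ S, G.s e = w) :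
    vertex R G w * complementIdem R G w S = complementIdem R G w S := by
  simpa [star_complementIdem] using congrArg star (complementIdem_mul_vertex (R := R) hS)

theorem complementIdem_idem (hS : ∀ e ∈ S, G.s e = w) :
    complementIdem R G w S * complementIdem R G w S = complementIdem R G w S := by
  nth_rewrite 2 [complementIdem]
  rw [mul_sub, complementIdem_mul_vertex hS, Finset.mul_sum, Finset.sum_eq_zero, sub_zero]
  intro e he
  rw [← mul_assoc, complementIdem_mul_edge hS he, zero_mul]

/-- Compressing by the complement of sufficiently many edges leaves a multiple of an idempotent. -/
theorem exists_compression_eq_smul {n : ℕ} {z : LeavittPathAlgebra R G}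
    (hz : z ∈ shortSpan R G n w) :
    ∃ (r : R) (S : Finset E), (∀ e ∈ S, G.s e = w) ∧
      ∀ S', S ⊆ S' → (∀ e ∈ S', G.s e = w) →
        complementIdem R G w S' * z * complementIdem R G w S' =
          r • complementIdem R G w S' := by
  classical
  induction hz using Submodule.span_induction with
  | zero => exact ⟨0, ∅, by simp, by simp⟩
  | add x y _ _ hx hy =>
    obtain ⟨r, S, hS, h⟩ := hx
    obtain ⟨r₂, S₂, hS₂, h₂⟩ := hy
    -- Taking the union is legitimate because the conclusion is claimed for every larger set of
    -- edges at `w`.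
    refine ⟨r + r₂, S ∪ S₂, fun e he => (Finset.mem_union.1 he).elim (hS e) (hS₂ e),
      fun S' hSS' hS' => ?_⟩
    rw [mul_add, add_mul, h S' (Finset.union_subset_left hSS') hS',
      h₂ S' (Finset.union_subset_right hSS') hS', add_smul]
  | smul t x _ hx =>
    obtain ⟨r, S, hS, h⟩ := hx
    refine ⟨t * r, S, hS, fun S' hSS' hS' => ?_⟩
    rw [mul_smul_comm, smul_mul_assoc, h S' hSS' hS', mul_smul]
  | mem z hz =>
    -- Putting the first edge of a nontrivial `α` or `β` into `S` makes the compression vanish; only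
    -- `α = β = w` survives, with coefficient `1`.
    obtain ⟨α, β, hα, hβ, hr, -, rfl⟩ := hz
    cases α with
    | nil =>
      cases β with
      | nil =>
        refine ⟨1, ∅, by simp, fun S' _ hS' => ?_⟩
        rw [monomial, star_vertex, (isLeavittFamily R G).vertex_idem,
          complementIdem_mul_vertex hS', complementIdem_idem hS', one_smul]
      | cons e β =>
        refine ⟨0, {e}, fun f hf => Finset.mem_singleton.1 hf ▸ hβ.1, fun S' hSS' hS' => ?_⟩
        rw [mul_assoc, mul_assoc,
          star_monomial_mul_complementIdem hS' (hSS' (Finset.mem_singleton_self e))]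
        simp
    | cons e α =>
      refine ⟨0, {e}, fun f hf => Finset.mem_singleton.1 hf ▸ hα.1, fun S' hSS' hS' => ?_⟩
      rw [← mul_assoc,
        complementIdem_mul_monomial hS' (hSS' (Finset.mem_singleton_self e))]
      simp

end Compression

/-! ### The base case: closed paths with and without exits -/

section ClosedPaths

/-- An element of `shortSpan R G 0 w` is a combination of `w`, closed paths, and closed ghost
paths. -/
theorem exists_eq_of_mem_shortSpan_zero {w : V} {z : LeavittPathAlgebra R G}
    (hz : z ∈ shortSpan R G 0 w) :
    ∃ (r : R) (a b : List E →₀ R), (∀ d ∈ a.support, d ∈ G.closedPaths w) ∧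
      (∀ d ∈ b.support, d ∈ G.closedPaths w) ∧
      z = r • vertex R G w + a.sum (fun d t => t • monomial R G w d) +
        b.sum (fun d t => t • star (monomial R G w d)) := by
  classical
  induction hz using Submodule.span_induction with
  | zero => exact ⟨0, 0, 0, by simp, by simp, by simp⟩
  | add x y _ _ hx hy =>
    obtain ⟨r, a, b, ha, hb, rfl⟩ := hx
    obtain ⟨r', a', b', ha', hb', rfl⟩ := hy
    refine ⟨r + r', a + a', b + b', fun d hd => ?_, fun d hd => ?_, ?_⟩
    · exact (Finset.mem_union.1 (Finsupp.support_add hd)).elim (ha d) (ha' d)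
    · exact (Finset.mem_union.1 (Finsupp.support_add hd)).elim (hb d) (hb' d)
    · have hadd : ∀ (f : List E → LeavittPathAlgebra R G) (c c' : List E →₀ R),
          (c + c').sum (fun d t => t • f d) =
            c.sum (fun d t => t • f d) + c'.sum fun d t => t • f d := fun f c c' =>
        Finsupp.sum_add_index' (fun d => zero_smul R (f d)) fun d t t' => add_smul t t' (f d)
      rw [hadd, hadd, add_smul]
      abel
  | smul t x _ hx =>
    obtain ⟨r, a, b, ha, hb, rfl⟩ := hx
    refine ⟨t * r, t • a, t • b, fun d hd => ha d (Finsupp.support_smul hd),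
      fun d hd => hb d (Finsupp.support_smul hd), ?_⟩
    have hsmul : ∀ (f : List E → LeavittPathAlgebra R G) (c : List E →₀ R),
        (t • c).sum (fun d u => u • f d) = c.sum fun d u => (t • u) • f d := fun f c =>
      Finsupp.sum_smul_index' fun d => zero_smul R (f d)
    rw [hsmul, hsmul]
    simp only [smul_add, Finsupp.smul_sum, smul_smul, smul_eq_mul]
  | mem z hz =>
    -- One of the two paths is trivial, so the common range is `w` and the other path is closed.
    obtain ⟨α, β, hα, hβ, hr, hm, rfl⟩ := hz
    cases α with
    | nil =>
      have hβ1 : monomial R G w [] * star (monomial R G w β) = star (monomial R G w β) := by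
        simpa [← hr, monomial, endpoint] using vertex_mul_star_monomial (R := R) (G := G) w β
      rw [hβ1]
      cases β with
      | nil => exact ⟨1, 0, 0, by simp, by simp, by simp [monomial]⟩
      | cons e β =>
        refine ⟨0, 0, Finsupp.single (e :: β) 1, by simp, fun d hd => ?_, by simp⟩
        rw [Finset.mem_singleton.1 (Finsupp.support_single_subset hd)]
        exact ⟨hβ, hr.symm, by simp⟩
    | cons e α =>
      have hβ' : β = [] := by
        simp only [List.length_cons] at hm
        exact List.length_eq_zero_iff.1 (by omega)
      subst hβ'
      have hr' : G.endpoint w (e :: α) = w := hr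
      have hα1 : monomial R G w (e :: α) * star (monomial R G w []) =
          monomial R G w (e :: α) := by
        have h := monomial_mul_vertex (R := R) (G := G) w (e :: α)
        rw [hr'] at h
        change _ * star (vertex R G w) = _
        rw [star_vertex, h]
      rw [hα1]
      refine ⟨0, Finsupp.single (e :: α) 1, 0, fun d hd => ?_, by simp, by simp⟩
      rw [Finset.mem_singleton.1 (Finsupp.support_single_subset hd)]
      exact ⟨hα, hr', by simp⟩

/-- If a path `η` is no prefix of `d η`, then `d` has coefficient zero in a central element. -/
theorem coeff_eq_zero_of_central {w : V} {x : LeavittPathAlgebra R G}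
    (hx : ∀ y, y * x = x * y) {r : R} {a b : List E →₀ R}
    (ha : ∀ d ∈ a.support, d ∈ G.closedPaths w)
    (hxw : x * vertex R G w = r • vertex R G w + a.sum (fun d t => t • monomial R G w d) +
        b.sum (fun d t => t • star (monomial R G w d))) {d : List E} (hd : d ∈ G.closedPaths w)
    {η : List E} (hη : G.IsPathFrom w η) (hdη : ¬ η <+: d ++ η) : a d = 0 := by
  classical
  obtain ⟨hd1, hd2, hd3⟩ := hd
  have : Nonempty E := ⟨d.head hd3⟩
  obtain ⟨D, T, hDv, hDe, hDg, hDm, hT1, hT0⟩ :=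
    exists_degree_functional R G (G.endpoint w η)
  have hDmon : ∀ (l : List E) (v : V), monomial R G v l ∈ D l.length := by
    intro l
    induction l with
    | nil => exact fun v => hDv v
    | cons e l ih =>
      intro v
      have := hDm 1 l.length _ _ (hDe e) (ih (G.r e))
      rw [List.length_cons, Nat.cast_succ, add_comm]
      exact this
  have hDstar : ∀ (l : List E) (v : V), star (monomial R G v l) ∈ D (-(l.length : ℤ)) := by
    intro l
    induction l with
    | nil =>
      intro v
      rw [monomial, star_vertex]
      exact hDv v
    | cons e l ih =>
      intro v
      have := hDm _ _ _ _ (ih (G.r e)) (hDg e)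
      rw [monomial, star_mul, star_edge, List.length_cons, Nat.cast_succ, neg_add]
      exact this
  have hη' : G.IsPathFrom (G.endpoint w d) η := hd2.symm ▸ hη
  have hdpath : G.IsPathFrom w (d ++ η) := isPathFrom_append.2 ⟨hd1, hη'⟩
  have hmon : monomial R G w (d ++ η) = monomial R G w d * monomial R G w η := by
    rw [monomial_append hη', hd2]
  set A := star (monomial R G w (d ++ η)) with hA
  set B := monomial R G w η with hB
  -- Besides `hdη`, this uses that `d η` is longer than `η` and so not a prefix of it.
  have hAB : A * B = 0 := by
    refine star_monomial_mul_eq_zero hdpath hη (fun h => ?_) hdη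
    have h1 := h.length_le
    rw [List.length_append] at h1
    exact hd3 (List.length_eq_zero_iff.1 (by omega))
  -- Write `B = B B* B` and move the first `B` left past `x`, where it meets `A`.
  have hzero : A * (x * vertex R G w) * B = 0 := by
    have h1 : B * star B * B = B := monomial_mul_star_mul_self hη
    rw [mul_assoc, mul_assoc x, hB, vertex_mul_monomial hη, ← hB, ← h1, mul_assoc B, ← mul_assoc x,
      ← hx B, mul_assoc B, ← mul_assoc A, hAB, zero_mul]
  rw [hxw, mul_add, mul_add, add_mul, add_mul, mul_smul_comm, smul_mul_assoc, mul_assoc A, hB,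
    vertex_mul_monomial hη, ← hB, hAB, smul_zero, zero_add] at hzero
  -- `T` isolates `d`: the term for `d` is `(d η)* (d η) = r(η)`, a different path of equal length
  -- gives `d* d' = 0`, and any other length gives the nonzero degree `|d'| - |d|`.
  have hTa : ∀ d' ∈ a.support, T (A * monomial R G w d' * B) = if d' = d then 1 else 0 := by
    intro d' hd'
    obtain ⟨hp, he, -⟩ := ha d' hd'
    split_ifs with hdd
    · subst hdd
      rw [mul_assoc, ← hmon, hA, star_monomial_mul_self hdpath, endpoint_append, hd2, hT1]
    · by_cases hlen : d'.length = d.length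
      · rw [hA, hmon, star_mul, mul_assoc (star B), star_monomial_mul_eq_zero hd1 hp, mul_zero,
          zero_mul, map_zero]
        · exact fun h => hdd (h.eq_of_length hlen.symm).symm
        · exact fun h => hdd (h.eq_of_length hlen)
      · refine hT0 _ _ (hDm _ _ _ _ (hDm _ _ _ _ (hDstar _ _) (hDmon _ _)) (hDmon _ _)) ?_
        rw [List.length_append]
        omega
  -- These terms have degree `-|d| - |d'|`, negative because `d` is nonempty.
  have hTb : ∀ d' ∈ b.support, T (A * star (monomial R G w d') * B) = 0 := by
    intro d' hd'
    refine hT0 _ _ (hDm _ _ _ _ (hDm _ _ _ _ (hDstar _ _) (hDstar _ _)) (hDmon _ _)) ?_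
    have := List.length_pos_iff.2 hd3
    rw [List.length_append]
    omega
  have h := congrArg T hzero
  rw [map_zero, map_add, Finsupp.sum, Finsupp.sum, Finset.mul_sum, Finset.mul_sum, Finset.sum_mul,
    Finset.sum_mul, map_sum, map_sum] at h
  simp only [mul_smul_comm, smul_mul_assoc, map_smul] at h
  rw [Finset.sum_congr rfl fun d' hd' => by rw [hTa d' hd'],
    Finset.sum_eq_zero (s := b.support) fun d' hd' => by rw [hTb d' hd', smul_zero],
    add_zero] at h
  by_contra hne
  rw [Finset.sum_eq_single_of_mem d (Finsupp.mem_support_iff.2 hne)] at h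
  · simp at h
    exact hne h
  · intro d' _ hdd
    simp [hdd]

/-- Without exits, all closed paths at `w` and their ghosts are normal. A single exit on a single
closed path instead kills all coefficients except that of `w`. -/
theorem mul_vertex_mem_core_of_mem_shortSpan_zero {w : V} {x : LeavittPathAlgebra R G}
    (hx : ∀ y, y * x = x * y) (h : x * vertex R G w ∈ shortSpan R G 0 w) :
    x * vertex R G w ∈ commutativeCore R G := by
  obtain ⟨r, a, b, ha, hb, hxw⟩ := exists_eq_of_mem_shortSpan_zero h
  by_cases hexit : ∀ c ∈ G.closedPaths w, ∀ g ∈ c, ∀ f, G.s f = G.s g → f = g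
  · have hmem : ∀ d ∈ G.closedPaths w, monomial R G w d ∈ commutativeCore R G ∧
        star (monomial R G w d) ∈ commutativeCore R G := by
      intro d hd
      have hcois := monomial_mul_star_self_of_no_exit (R := R) hd.1 (hexit d hd)
      have hww : monomial R G w [] * star (monomial R G w []) = vertex R G w := by
        rw [monomial, star_vertex, (isLeavittFamily R G).vertex_idem]
      have h1 := monomial_mul_star_mem_core (R := R) (β := []) (v := w) hd.1 trivial hd.2.1
        (hcois.trans hww.symm)
      have h2 := monomial_mul_star_mem_core (R := R) (α := []) (u := w) trivial hd.1 hd.2.1.symm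
        (hww.trans hcois.symm)
      have h3 := monomial_mul_vertex (R := R) (G := G) w d
      have h4 := vertex_mul_star_monomial (R := R) (G := G) w d
      rw [hd.2.1] at h3 h4
      rw [monomial, star_vertex, h3] at h1
      rw [monomial, h4] at h2
      exact ⟨h1, h2⟩
    rw [hxw]
    refine add_mem (add_mem (SMulMemClass.smul_mem r (vertex_mem_core w)) ?_) ?_
    · exact sum_mem fun d hd => SMulMemClass.smul_mem _ (hmem d (ha d hd)).1
    · exact sum_mem fun d hd => SMulMemClass.smul_mem _ (hmem d (hb d hd)).2
  · push Not at hexit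
    obtain ⟨c, hc, g, hg, f, hfg, hne⟩ := hexit
    obtain ⟨τ, σ, rfl⟩ := List.append_of_mem hg
    -- The path runs `k` times around the closed path, follows it up to the exit and leaves through
    -- `f`. For a given `d`, `k = |d|` turns suffice.
    have hη : ∀ k, G.IsPathFrom w ((List.replicate k (τ ++ g :: σ)).flatten ++ (τ ++ [f])) := by
      intro k
      have h1 := flatten_replicate_closed hc.1 hc.2.1 k
      have h2 := isPathFrom_append.1 hc.1
      rw [isPathFrom_append, h1.2, isPathFrom_append]
      exact ⟨h1.1, h2.1, hfg.trans h2.2.1, trivial⟩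
    -- The involution preserves centrality and exchanges `a` with `b`, so the ghost coefficients are
    -- handled by the same lemma.
    have hxstar : ∀ y, y * star x = star x * y := fun y => by
      simpa using (congrArg star (hx (star y))).symm
    have hxw' : star x * vertex R G w = r • vertex R G w +
        b.sum (fun d t => t • monomial R G w d) +
        a.sum (fun d t => t • star (monomial R G w d)) := by
      have h1 := congrArg star hxw
      rw [← hx, star_mul, star_vertex] at h1
      rw [h1, star_add, star_add, star_smul_eq, star_vertex, Finsupp.sum, Finsupp.sum, star_sum,
        star_sum, add_right_comm]
      simp only [star_smul_eq, star_star]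
      rfl
    have ha0 : a = 0 := by
      ext d
      by_contra h0
      have hd := ha d (Finsupp.mem_support_iff.2 h0)
      exact h0 (coeff_eq_zero_of_central hx ha hxw hd (hη d.length)
        (not_prefix_of_exit hne hd.2.2))
    have hb0 : b = 0 := by
      ext d
      by_contra h0
      have hd := hb d (Finsupp.mem_support_iff.2 h0)
      exact h0 (coeff_eq_zero_of_central hxstar hb hxw' hd (hη d.length)
        (not_prefix_of_exit hne hd.2.2))
    rw [hxw, ha0, hb0, Finsupp.sum_zero_index, Finsupp.sum_zero_index, add_zero, add_zero]
    exact SMulMemClass.smul_mem r (vertex_mem_core w)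

end ClosedPaths

/-! ### Induction on the length bound, and the conclusion -/

theorem mul_vertex_mem_core {x : LeavittPathAlgebra R G} (hx : ∀ y, y * x = x * y) (n : ℕ) :
    ∀ w, x * vertex R G w ∈ shortSpan R G n w → x * vertex R G w ∈ commutativeCore R G := by
  induction n with
  | zero => exact fun w h => mul_vertex_mem_core_of_mem_shortSpan_zero hx h
  | succ n ih =>
    intro w h
    obtain ⟨r, S, hS, hq⟩ := exists_compression_eq_smul h
    have hq := hq S subset_rfl hS
    set q := complementIdem R G w S with hq_def
    -- Centrality and `q q = q` turn `q (x w) q` into `x q`.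
    have hxq : x * q = r • q := by
      rw [← hq, ← mul_assoc, hx, mul_assoc, mul_assoc, vertex_mul_complementIdem hS,
        complementIdem_idem hS]
    have hsplit : x * vertex R G w = x * q + ∑ e ∈ S, x * (edge R G e * ghost R G e) := by
      rw [hq_def, complementIdem, mul_sub, Finset.mul_sum, sub_add_cancel]
    rw [hsplit, hxq]
    refine add_mem (SMulMemClass.smul_mem r (complementIdem_mem_core w S)) (sum_mem fun e he => ?_)
    -- This identity places `x r(e)` in the span with bound `n`, at a new vertex; hence the
    -- quantifier over `w` inside the induction.
    have h1 : ghost R G e * (x * vertex R G w) * edge R G e = x * vertex R G (G.r e) := by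
      rw [← hS e he, ← mul_assoc, hx, mul_assoc x, (isLeavittFamily R G).ghost_source, mul_assoc,
        (isLeavittFamily R G).ghost_edge_self]
    have h2 : x * vertex R G (G.r e) ∈ commutativeCore R G := by
      apply ih
      rw [← h1]
      apply ghost_mul_mul_edge_mem_shortSpan
      rwa [hS e he]
    have h3 : x * (edge R G e * ghost R G e) =
        edge R G e * (x * vertex R G (G.r e)) * ghost R G e := by
      rw [← mul_assoc, ← mul_assoc, hx, mul_assoc x, mul_assoc x, mul_assoc x,
        (isLeavittFamily R G).edge_range]
    rw [h3]
    exact edge_mul_mul_ghost_mem_core e h2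

end LeavittPathAlgebra

/-- The center of a Leavitt path algebra is contained in its commutative core. -/
theorem mainTheorem11 {V : Type*} {E : Type*} (G : DirectedGraph V E)
    (R : Type*) [CommRing R] :
    NonUnitalSubalgebra.center R (LeavittPathAlgebra R G) ≤
      LeavittPathAlgebra.commutativeCore R G := by
  intro x hx
  have hx' : ∀ y, y * x = x * y := fun y => NonUnitalSubalgebra.mem_center_iff.1 hx y
  obtain ⟨F, hF⟩ := LeavittPathAlgebra.exists_sum_mul_vertex_eq x
  rw [← hF F subset_rfl]
  refine sum_mem fun w _ => ?_
  obtain ⟨n, hn⟩ := LeavittPathAlgebra.exists_mem_shortSpan x w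
  refine LeavittPathAlgebra.mul_vertex_mem_core hx' n w ?_
  rwa [hx', mul_assoc, (LeavittPathAlgebra.isLeavittFamily R G).vertex_idem] at hn
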